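/- For a square complex matrix $X$, the Drazin inverse $X^D$ is the unique matrix with $XX^D=X^DX$, $X^D=X^DXX^D$ and $X^k=X^{k+1}X^D$ for some $k\in\mathbb N$; put $X^\pi=I-XX^D$. **Notation $(*)$.** For square complex matrices $E,F$ of the same size put $$A_1=-F^DEF^D,\quad B_1=(F^D)^2+F^D(EF^D)^2,\quad C_1=F^D+FF^D(EF^D)^2,$$ $$D_1=-F^DEF^D-FF^DE(F^D)^2-FF^D(EF^D)^3,$$ and for $i\ge 1$ $$A_{i+1}=F^DA_i-F^DEF^DC_i,\qquad B_{i+1}=F^DB_i-F^DEF^DD_i,$$ $$C_{i+1}=-FF^DEF^DA_i+(F^D+FF^D(EF^D)^2)C_i,\qquad D_{i+1}=-FF^DEF^DB_i+(F^D+FF^D(EF^D)^2)D_i .$$ Let $W=E^\pi-\sum_{j=1}^{\infty}(E^D)^{2j}F^j$ and, for $i\ge1$ (sums over $0\le k\le i-2$ are empty for $i=1$), $$U_i=WF^iF^\pi E+E^\pi E^{2i}F^\pi EFF^D+\sum_{k=0}^{i-2}E^\pi E^{2k+2}F^{i-k-1}F^\pi E,$$ $$V_i=E^\pi E^{2i-1}F^\pi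 EFF^D-\sum_{j=0}^{\infty}(E^D)^{2j+1}F^{i+j}F^\pi E+\sum_{k=0}^{i-2}E^\pi E^{2k+1}F^{i-k-1}F^\pi E .$$ Define $$\Gamma=\sum_{i=0}^{\infty}(E^D)^{2i+1}F^iF^\pi+WF^\pi EF^D+\sum_{i=1}^{\infty}U_iF^DC_i+\sum_{i=1}^{\infty}V_iA_i,$$ $$\Delta=F^D-E^DF^\pi EF^D-\sum_{i=1}^{\infty}(E^D)^{2i+1}F^iF^\pi EF^D+\sum_{i=0}^{\infty}(E^D)^{2i+2}F^iF^\pi-WF^\pi EF^DEF^D+\sum_{i=1}^{\infty}U_iF^DD_i+\sum_{i=1}^{\infty}V_iB_i,$$ $$\Lambda=FF^D+\sum_{i=1}^{\infty}F^iF^\pi EA_i,\qquad \Xi=-FF^DEF^D+\sum_{i=1}^{\infty}F^iF^\pi EB_i .$$ **Theorem 3.1.** Let $M=\begin{pmatrix}A&B\\C&D\end{pmatrix}$ with $A\in\mathbb C^{m\times m}$, $B\in\mathbb C^{m\times n}$, $C\in\mathbb C^{n\times m}$, $D\in\mathbb C^{n\times n}$. Suppose that $BCB=0$, $DCB=0$,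 $BCA(BC)^\pi=0$ and $DCA(BC)^\pi=0$. Put $$E=\begin{pmatrix}A&B\\0&D\end{pmatrix},\quad F=\begin{pmatrix}BC&0\\DC&0\end{pmatrix},\quad L=\begin{pmatrix}0&0&0&0\\0&0&0&0\\0&0&0&0\\0&0&C&0\end{pmatrix},\quad K=\begin{pmatrix}A&B&BC&0\\0&D&DC&0\\I&0&0&0\\0&I&0&0\end{pmatrix}.$$ Then all the infinite series in $(*)$ for this pair $E,F$ converge, $$K^D=\begin{pmatrix}A&B&I&0\\0&D&0&I\\I&0&0&0\\0&I&0&0\end{pmatrix}\begin{pmatrix}\Gamma&\Delta\\\Lambda&\Xi\end{pmatrix}^2\begin{pmatrix}I&0&0&0\\0&I&0&0\\0&0&BC&0\\0&0&DC&0\end{pmatrix},$$ and $$M^D=\begin{pmatrix}I&0&0&0\\0&I&C&0\end{pmatrix}\big[K^D+L(K^D)^2\big]^2\begin{pmatrix}A&B\\0&D\\I&0\\0&I\end{pmatrix}.$$ -/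

import Mathlib

namespace BlockDrazin

section Drazin

variable {k : Type*} [Fintype k] [DecidableEq k]

/-- `X` is a Drazin inverse of the square complex matrix `A`. -/
def IsDrazinInverse (A X : Matrix k k ℂ) : Prop :=
  A * X = X * A ∧ X = X * A * X ∧ ∃ m : ℕ, A ^ m = A ^ (m + 1) * X

theorem exists_isDrazinInverse (A : Matrix k k ℂ) : ∃ X, IsDrazinInverse A X := by
  -- Some power satisfies `A ^ r = A ^ (r + 1) * Y` with `Y` commuting with `A`.
  obtain ⟨r, Y, hY, hr⟩ : ∃ (r : ℕ) (Y : Matrix k k ℂ), Commute A Y ∧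
      A ^ r = A ^ (r + 1) * Y := by
    obtain ⟨q, hq, hq0⟩ := Polynomial.exists_eq_pow_rootMultiplicity_mul_and_not_dvd
      A.charpoly A.charpoly_monic.ne_zero 0
    set r := Polynomial.rootMultiplicity 0 A.charpoly
    rw [map_zero, sub_zero] at hq hq0
    have hc : q.coeff 0 ≠ 0 := fun h => hq0 (Polynomial.X_dvd_iff.2 h)
    refine ⟨r, Polynomial.aeval A (-(Polynomial.C (q.coeff 0)⁻¹ * q.divX)), ?_, ?_⟩
    · have h := (Commute.all (Polynomial.X : Polynomial ℂ)
        (-(Polynomial.C (q.coeff 0)⁻¹ * q.divX))).map (Polynomial.aeval A)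
      rwa [Polynomial.aeval_X] at h
    · have h0 : Polynomial.aeval A A.charpoly = 0 := Matrix.aeval_self_charpoly A
      have h1 : (Polynomial.X : Polynomial ℂ) ^ r
          - Polynomial.X ^ (r + 1) * (-(Polynomial.C (q.coeff 0)⁻¹ * q.divX))
          = A.charpoly * Polynomial.C (q.coeff 0)⁻¹ := by
        have h2 : (Polynomial.C (q.coeff 0) * Polynomial.C (q.coeff 0)⁻¹ : Polynomial ℂ) = 1 := by
          rw [← Polynomial.C_mul, mul_inv_cancel₀ hc, Polynomial.C_1]
        have h4 := Polynomial.divX_mul_X_add q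
        rw [hq]
        linear_combination (-(Polynomial.X : Polynomial ℂ) ^ r) * h2
          + (Polynomial.X : Polynomial ℂ) ^ r * Polynomial.C (q.coeff 0)⁻¹ * h4
      have h3 := congrArg (Polynomial.aeval A) h1
      simp only [map_sub, map_mul, map_pow, Polynomial.aeval_X, h0, zero_mul] at h3
      rw [map_neg, map_mul]
      rw [map_neg, map_mul] at h3
      exact sub_eq_zero.1 h3
  have hj : ∀ j : ℕ, A ^ r = A ^ (r + j) * Y ^ j := by
    intro j
    induction j with
    | zero => simp
    | succ j ih =>
      calc A ^ r = A ^ j * A ^ r * Y ^ j := by rw [← pow_add, add_comm j r]; exact ih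
        _ = A ^ j * (A ^ (r + 1) * Y) * Y ^ j := by rw [← hr]
        _ = A ^ (r + (j + 1)) * Y ^ (j + 1) := by
          rw [pow_succ' Y, show r + (j + 1) = j + (r + 1) by omega, pow_add A j]
          simp only [mul_assoc]
  have hYA : ∀ a b : ℕ, Y ^ a * A ^ b = A ^ b * Y ^ a := fun a b =>
    ((hY.pow_pow b a).eq).symm
  refine ⟨A ^ r * Y ^ (r + 1), ?_, ?_, r, ?_⟩
  · have h1 := hYA (r + 1) 1
    rw [pow_one] at h1
    rw [mul_assoc, h1, ← mul_assoc, ← mul_assoc, ← pow_succ, ← pow_succ']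
  · symm
    calc A ^ r * Y ^ (r + 1) * A * (A ^ r * Y ^ (r + 1))
        = A ^ r * (Y ^ (r + 1) * A ^ (r + 1)) * Y ^ (r + 1) := by
          rw [pow_succ' A r]; simp only [mul_assoc]
      _ = A ^ r * (A ^ (r + 1) * Y ^ (r + 1)) * Y ^ (r + 1) := by rw [hYA]
      _ = (A ^ (r + (r + 1)) * Y ^ (r + 1)) * Y ^ (r + 1) := by
          rw [pow_add A r (r + 1)]; simp only [mul_assoc]
      _ = A ^ r * Y ^ (r + 1) := by rw [← hj (r + 1)]
  · rw [← mul_assoc, ← pow_add, show r + 1 + r = r + (r + 1) by omega]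
    exact hj (r + 1)

theorem IsDrazinInverse.unique {A X Y : Matrix k k ℂ} (hX : IsDrazinInverse A X)
    (hY : IsDrazinInverse A Y) : X = Y := by
  -- `X = X ^ (j + 1) * A ^ j` and `A ^ m = A ^ (m + 1) * X` for a common large exponent.
  have key : ∀ Z : Matrix k k ℂ, IsDrazinInverse A Z →
      (∀ j : ℕ, Z = Z ^ (j + 1) * A ^ j) ∧ (∃ m : ℕ, ∀ n, m ≤ n → A ^ n = A ^ (n + 1) * Z) := by
    rintro Z ⟨h1, h2, m, h3⟩
    constructor
    · intro j
      induction j with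
      | zero => simp
      | succ j ih =>
        have h4 : Z * Z * A = Z := by rw [mul_assoc, ← h1, ← mul_assoc]; exact h2.symm
        calc Z = Z ^ j * Z * A ^ j := by rw [← pow_succ]; exact ih
          _ = Z ^ j * (Z * Z * A) * A ^ j := by rw [h4]
          _ = Z ^ (j + 1 + 1) * A ^ (j + 1) := by
            rw [pow_succ' A, pow_succ Z (j + 1), pow_succ Z j]; simp only [mul_assoc]
    · refine ⟨m, fun n hn => ?_⟩
      obtain ⟨d, rfl⟩ := Nat.exists_eq_add_of_le' hn
      rw [pow_add, h3, ← mul_assoc, ← pow_add, add_assoc]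
  obtain ⟨hXp, mX, hXm⟩ := key X hX
  obtain ⟨hYp, mY, hYm⟩ := key Y hY
  have cX : Commute A X := hX.1
  have cY : Commute A Y := hY.1
  obtain ⟨n, hnX, hnY⟩ : ∃ n, mX ≤ n ∧ mY ≤ n := ⟨max mX mY, le_max_left _ _, le_max_right _ _⟩
  -- Both sides equal `X * A * Y`.
  have hA : X = X * A * Y := by
    calc X = X ^ (n + 1) * A ^ n := hXp n
      _ = X ^ (n + 1) * (A ^ (n + 1) * Y) := by rw [← hYm n hnY]
      _ = (X ^ (n + 1) * A ^ n) * A * Y := by rw [pow_succ A]; simp only [mul_assoc]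
      _ = X * A * Y := by rw [← hXp n]
  have hB : Y = X * A * Y := by
    calc Y = Y ^ (n + 1) * A ^ n := hYp n
      _ = A ^ n * Y ^ (n + 1) := ((cY.pow_pow n (n + 1)).eq).symm
      _ = (A ^ (n + 1) * X) * Y ^ (n + 1) := by rw [← hXm n hnX]
      _ = (X * A ^ (n + 1)) * Y ^ (n + 1) := by rw [(cX.pow_left (n + 1)).eq]
      _ = X * A * (A ^ n * Y ^ (n + 1)) := by rw [pow_succ' A]; simp only [mul_assoc]
      _ = X * A * (Y ^ (n + 1) * A ^ n) := by rw [(cY.pow_pow n (n + 1)).eq]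
      _ = X * A * Y := by rw [← hYp n]
  rw [hA, ← hB]

/-- The Drazin inverse `A^D`. -/
noncomputable def drazin (A : Matrix k k ℂ) : Matrix k k ℂ :=
  Classical.choose (exists_isDrazinInverse A)

theorem isDrazinInverse_drazin (A : Matrix k k ℂ) : IsDrazinInverse A (drazin A) :=
  Classical.choose_spec (exists_isDrazinInverse A)

/-- The eigenprojection `A^π = I - A A^D`. -/
noncomputable def eigenproj (A : Matrix k k ℂ) : Matrix k k ℂ := 1 - A * drazin A

end Drazin

section Star

variable {k : Type*} [Fintype k] [DecidableEq k]

/-- A quadruple `(A_i, B_i, C_i, D_i)` of coefficient matrices. -/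
structure Quad (k : Type*) where
  a : Matrix k k ℂ
  b : Matrix k k ℂ
  c : Matrix k k ℂ
  d : Matrix k k ℂ

/-- `coeff E F i` is the quadruple `(A_{i+1}, B_{i+1}, C_{i+1}, D_{i+1})`; the recursion starts
with `(A_1, B_1, C_1, D_1)` at `i = 0`. -/
noncomputable def coeff (E F : Matrix k k ℂ) : ℕ → Quad k
  | 0 =>
    { a := -(drazin F * E * drazin F)
      b := drazin F ^ 2 + drazin F * (E * drazin F) ^ 2
      c := drazin F + F * drazin F * (E * drazin F) ^ 2
      d := -(drazin F * E * drazin F) - F * drazin F * E * drazin F * drazin F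
        - F * drazin F * (E * drazin F) ^ 3 }
  | i + 1 =>
    { a := drazin F * (coeff E F i).a - drazin F * E * drazin F * (coeff E F i).c
      b := drazin F * (coeff E F i).b - drazin F * E * drazin F * (coeff E F i).d
      c := -(F * drazin F * E * drazin F * (coeff E F i).a)
        + (drazin F + F * drazin F * (E * drazin F) ^ 2) * (coeff E F i).c
      d := -(F * drazin F * E * drazin F * (coeff E F i).b)
        + (drazin F + F * drazin F * (E * drazin F) ^ 2) * (coeff E F i).d }

/-- `A_i`, meaningful for `i ≥ 1`; similarly `coB`, `coC`, `coD`. -/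
noncomputable def coA (E F : Matrix k k ℂ) (i : ℕ) : Matrix k k ℂ := (coeff E F (i - 1)).a
noncomputable def coB (E F : Matrix k k ℂ) (i : ℕ) : Matrix k k ℂ := (coeff E F (i - 1)).b
noncomputable def coC (E F : Matrix k k ℂ) (i : ℕ) : Matrix k k ℂ := (coeff E F (i - 1)).c
noncomputable def coD (E F : Matrix k k ℂ) (i : ℕ) : Matrix k k ℂ := (coeff E F (i - 1)).d

/-- `E^π - ∑_{j ≥ 1} (E^D)^{2j} F^j`. A sum over `j ≥ 1` is written as a sum over `j ≥ 0` with `j`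
replaced by `j + 1`, here and below. -/
noncomputable def W (E F : Matrix k k ℂ) : Matrix k k ℂ :=
  eigenproj E - (∑' j : ℕ, drazin E ^ (2 * (j + 1)) * F ^ (j + 1))

/-- The bracket that multiplies `F^D C_i` and `F^D D_i`, for `i ≥ 1`. The last sum runs over
`0 ≤ k ≤ i - 2` (empty for `i = 1`). -/
noncomputable def evenBracket (E F : Matrix k k ℂ) (i : ℕ) : Matrix k k ℂ :=
  W E F * F ^ i * eigenproj F * E
    + eigenproj E * E ^ (2 * i) * eigenproj F * E * F * drazin F
    + ∑ l ∈ Finset.range (i - 1),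
        eigenproj E * E ^ (2 * l + 2) * F ^ (i - l - 1) * eigenproj F * E

/-- The bracket that multiplies `A_i` and `B_i`, for `i ≥ 1`. The last sum runs over
`0 ≤ k ≤ i - 2` (empty for `i = 1`). -/
noncomputable def oddBracket (E F : Matrix k k ℂ) (i : ℕ) : Matrix k k ℂ :=
  eigenproj E * E ^ (2 * i - 1) * eigenproj F * E * F * drazin F
    - (∑' j : ℕ, drazin E ^ (2 * j + 1) * F ^ (i + j) * eigenproj F * E)
    + ∑ l ∈ Finset.range (i - 1),
        eigenproj E * E ^ (2 * l + 1) * F ^ (i - l - 1) * eigenproj F * E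

noncomputable def Gam (E F : Matrix k k ℂ) : Matrix k k ℂ :=
  (∑' i : ℕ, drazin E ^ (2 * i + 1) * F ^ i * eigenproj F)
    + W E F * eigenproj F * E * drazin F
    + (∑' i : ℕ, evenBracket E F (i + 1) * drazin F * coC E F (i + 1))
    + (∑' i : ℕ, oddBracket E F (i + 1) * coA E F (i + 1))

noncomputable def Del (E F : Matrix k k ℂ) : Matrix k k ℂ :=
  drazin F - drazin E * eigenproj F * E * drazin F
    - (∑' i : ℕ, drazin E ^ (2 * (i + 1) + 1) * F ^ (i + 1) * eigenproj F * E * drazin F)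
    + (∑' i : ℕ, drazin E ^ (2 * i + 2) * F ^ i * eigenproj F)
    - W E F * eigenproj F * E * drazin F * E * drazin F
    + (∑' i : ℕ, evenBracket E F (i + 1) * drazin F * coD E F (i + 1))
    + (∑' i : ℕ, oddBracket E F (i + 1) * coB E F (i + 1))

noncomputable def Lam (E F : Matrix k k ℂ) : Matrix k k ℂ :=
  F * drazin F + (∑' i : ℕ, F ^ (i + 1) * eigenproj F * E * coA E F (i + 1))

noncomputable def Xi (E F : Matrix k k ℂ) : Matrix k k ℂ :=
  -(F * drazin F * E * drazin F) + (∑' i : ℕ, F ^ (i + 1) * eigenproj F * E * coB E F (i + 1))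

/-- All the infinite series that occur in `Gam`, `Del`, `Lam`, `Xi` converge. -/
def SeriesConverge (E F : Matrix k k ℂ) : Prop :=
  Summable (fun j : ℕ => drazin E ^ (2 * (j + 1)) * F ^ (j + 1)) ∧
  (∀ i : ℕ, Summable
    (fun j : ℕ => drazin E ^ (2 * j + 1) * F ^ (i + 1 + j) * eigenproj F * E)) ∧
  Summable (fun i : ℕ => drazin E ^ (2 * i + 1) * F ^ i * eigenproj F) ∧
  Summable (fun i : ℕ => evenBracket E F (i + 1) * drazin F * coC E F (i + 1)) ∧
  Summable (fun i : ℕ => oddBracket E F (i + 1) * coA E F (i + 1)) ∧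
  Summable (fun i : ℕ =>
    drazin E ^ (2 * (i + 1) + 1) * F ^ (i + 1) * eigenproj F * E * drazin F) ∧
  Summable (fun i : ℕ => drazin E ^ (2 * i + 2) * F ^ i * eigenproj F) ∧
  Summable (fun i : ℕ => evenBracket E F (i + 1) * drazin F * coD E F (i + 1)) ∧
  Summable (fun i : ℕ => oddBracket E F (i + 1) * coB E F (i + 1)) ∧
  Summable (fun i : ℕ => F ^ (i + 1) * eigenproj F * E * coA E F (i + 1)) ∧
  Summable (fun i : ℕ => F ^ (i + 1) * eigenproj F * E * coB E F (i + 1))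

end Star

end BlockDrazin

open BlockDrazin Matrix

namespace BlockDrazin

/-! ### Drazin inverses of products, of sums and of one block matrix. -/

section General

open Matrix

variable {k l : Type*} [Fintype k] [DecidableEq k] [Fintype l] [DecidableEq l]

/-! The hypotheses are stronger than they look. From `BCB = 0` follows `(BC)² = 0`, so `(BC)^D = 0`
and `(BC)^π = I`; the last two hypotheses then say `BCA = DCA = 0`. Hence `FE = 0`, `F² = 0` and
`F^D = 0`: all coefficients `A_i, …, D_i` vanish, the remaining series have at most two nonzero
terms, and `Λ = Ξ = 0`.

The rest is two uses of Cline's formula `(PQ)^D = P ((QP)^D)² Q`. One factors `K = PQ` with `QP =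
[[E, I], [F, 0]]`, whose Drazin inverse is `drazin_fromBlocks_one_zero`. The other factors `M = UV`
with `VU = K + L`, where `KL = L² = 0`, so that `drazin_add_of_mul_eq_zero` applies. -/

theorem IsDrazinInverse.drazin_eq {A X : Matrix k k ℂ} (h : IsDrazinInverse A X) :
    drazin A = X :=
  (isDrazinInverse_drazin A).unique h

theorem IsDrazinInverse.mul_mul_self {A X : Matrix k k ℂ} (h : IsDrazinInverse A X) :
    A * (X * X) = X := by
  rw [← mul_assoc, h.1, ← h.2.1]

theorem drazin_eq_zero_of_mul_self {F : Matrix k k ℂ} (h : F * F = 0) : drazin F = 0 :=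
  IsDrazinInverse.drazin_eq ⟨by simp, by simp, 2, by simp [pow_two, h]⟩

theorem mul_pow_mul_comm (P : Matrix k l ℂ) (Q : Matrix l k ℂ) (r : ℕ) :
    (P * Q) ^ r * P = P * (Q * P) ^ r := by
  induction r with
  | zero => simp
  | succ r ih => rw [pow_succ', Matrix.mul_assoc, ih, pow_succ']; simp only [Matrix.mul_assoc]

/-- Cline's formula. -/
theorem drazin_mul_comm (P : Matrix k l ℂ) (Q : Matrix l k ℂ) :
    drazin (P * Q) = P * drazin (Q * P) ^ 2 * Q := by
  obtain ⟨hc, hx, r, hr⟩ := isDrazinInverse_drazin (Q * P)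
  have hs : (Q * P) * (drazin (Q * P) * drazin (Q * P)) = drazin (Q * P) :=
    IsDrazinInverse.mul_mul_self ⟨hc, hx, r, hr⟩
  generalize drazin (Q * P) = X at hc hx hr hs
  have hs' : X * X * (Q * P) = X := by rw [mul_assoc, ← hc, ← mul_assoc]; exact hx.symm
  have hL : P * Q * (P * X ^ 2 * Q) = P * X * Q := by
    calc P * Q * (P * X ^ 2 * Q) = P * (Q * P * (X * X)) * Q := by
          rw [pow_two]; simp only [Matrix.mul_assoc]
      _ = P * X * Q := by rw [hs]
  have hR : P * X ^ 2 * Q * (P * Q) = P * X * Q := by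
    calc P * X ^ 2 * Q * (P * Q) = P * (X * X * (Q * P)) * Q := by
          rw [pow_two]; simp only [Matrix.mul_assoc]
      _ = P * X * Q := by rw [hs']
  -- The index grows by one because `(PQ)^(r+1) = P (QP)^r Q`.
  refine IsDrazinInverse.drazin_eq ⟨hL.trans hR.symm, ?_, r + 1, ?_⟩
  · rw [hR]
    calc P * X ^ 2 * Q = P * (X * (Q * P * (X * X))) * Q := by rw [hs, pow_two]
      _ = P * X * Q * (P * X ^ 2 * Q) := by rw [pow_two]; simp only [Matrix.mul_assoc]
  · calc (P * Q) ^ (r + 1) = P * (Q * P) ^ r * Q := by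
          rw [pow_succ, ← Matrix.mul_assoc, mul_pow_mul_comm]
      _ = P * (Q * P) ^ (r + 1) * X * Q := by rw [hr]; simp only [Matrix.mul_assoc]
      _ = (P * Q) ^ (r + 1) * (P * X * Q) := by
          rw [← mul_pow_mul_comm]; simp only [Matrix.mul_assoc]
      _ = (P * Q) ^ (r + 1 + 1) * (P * X ^ 2 * Q) := by
          rw [pow_succ _ (r + 1), Matrix.mul_assoc _ (P * Q), hL]

/-- Since `KL = L² = 0`, `(K + L)^(j+1) = K^(j+1) + L K^j`; the formula is its formal value at
exponent `-1`. -/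
theorem drazin_add_of_mul_eq_zero {K L : Matrix k k ℂ} (hKL : K * L = 0) (hLL : L * L = 0) :
    drazin (K + L) = drazin K + L * drazin K ^ 2 := by
  obtain ⟨hc, hx, r, hr⟩ := isDrazinInverse_drazin K
  have hs : K * (drazin K * drazin K) = drazin K :=
    IsDrazinInverse.mul_mul_self ⟨hc, hx, r, hr⟩
  generalize drazin K = X at hc hx hr hs
  have hs' : X * X * K = X := by rw [mul_assoc, ← hc, ← mul_assoc]; exact hx.symm
  have hXL : X * L = 0 := by rw [← hs', mul_assoc, hKL, mul_zero]
  have hL : (K + L) * (X + L * X ^ 2) = K * X + L * X := by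
    rw [mul_add, add_mul, add_mul, ← mul_assoc K, ← mul_assoc L, hKL, hLL]; simp
  have hR : (X + L * X ^ 2) * (K + L) = K * X + L * X := by
    calc (X + L * X ^ 2) * (K + L) = X * K + L * (X * X * K) + (X * L + L * X * (X * L)) := by
          rw [pow_two]; noncomm_ring
      _ = K * X + L * X := by rw [hs', hXL, hc]; simp
  have hpow : ∀ j : ℕ, (K + L) ^ (j + 1) = K ^ (j + 1) + L * K ^ j := by
    intro j
    induction j with
    | zero => simp
    | succ j ih =>
      calc (K + L) ^ (j + 1 + 1)
          = K * K ^ (j + 1) + K * L * K ^ j + L * K ^ (j + 1) + L * L * K ^ j := by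
            rw [pow_succ', ih]; noncomm_ring
        _ = K ^ (j + 1 + 1) + L * K ^ (j + 1) := by
            rw [hKL, hLL, pow_succ' K (j + 1)]; simp
  refine IsDrazinInverse.drazin_eq ⟨hL.trans hR.symm, ?_, r + 1, ?_⟩
  · rw [hR]
    calc X + L * X ^ 2 = X * K * X + K * X * L * X ^ 2 + L * X * X + L * (X * L) * X ^ 2 := by
          rw [mul_assoc K X L, hXL, ← hx, pow_two]; noncomm_ring
      _ = (K * X + L * X) * (X + L * X ^ 2) := by rw [hc]; noncomm_ring
  · have hKL' : ∀ j : ℕ, K ^ (j + 1) * L = 0 := fun j => by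
      rw [pow_succ, mul_assoc, hKL, mul_zero]
    have hr' : K ^ (r + 1) = K ^ (r + 1 + 1) * X := by
      rw [pow_succ' K (r + 1), mul_assoc, ← hr, pow_succ']
    symm
    calc (K + L) ^ (r + 1 + 1) * (X + L * X ^ 2)
        = K ^ (r + 1 + 1) * X + L * (K ^ (r + 1) * X) + K ^ (r + 1 + 1) * L * X ^ 2
            + L * (K ^ (r + 1) * L) * X ^ 2 := by
          rw [hpow]; simp only [mul_add, add_mul, mul_assoc]; abel
      _ = (K + L) ^ (r + 1) := by rw [hKL', hKL', ← hr, ← hr', hpow]; simp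

/-- Again the formula for high powers (`hpow`) read at exponent `-1`, with `drazin E` in the role of
`E⁻¹`. -/
theorem drazin_fromBlocks_one_zero {E F : Matrix k k ℂ} (hFE : F * E = 0) (hFF : F * F = 0) :
    drazin (fromBlocks E 1 F 0) =
      fromBlocks (drazin E + drazin E ^ 3 * F) (drazin E ^ 2 + drazin E ^ 4 * F) 0 0 := by
  obtain ⟨hc, hx, r, hr⟩ := isDrazinInverse_drazin E
  have hs : E * (drazin E * drazin E) = drazin E :=
    IsDrazinInverse.mul_mul_self ⟨hc, hx, r, hr⟩
  generalize drazin E = X at hc hx hr hs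
  have hFX : F * X = 0 := by rw [← hs, ← mul_assoc, hFE, zero_mul]
  have hFX' : ∀ Z : Matrix k k ℂ, F * (X * Z) = 0 := fun Z => by rw [← mul_assoc, hFX, zero_mul]
  have hs' : ∀ Z : Matrix k k ℂ, E * (X * (X * Z)) = X * Z := fun Z => by
    rw [← mul_assoc X, ← mul_assoc E, hs]
  have hL : fromBlocks E 1 F 0 * fromBlocks (X + X ^ 3 * F) (X ^ 2 + X ^ 4 * F) 0 0
      = fromBlocks (E * X + X ^ 2 * F) (X + X ^ 3 * F) 0 0 := by
    rw [fromBlocks_multiply]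
    congr 1 <;> simp [mul_add, pow_succ, mul_assoc, hs, hs', hFX, hFX']
  have hR : fromBlocks (X + X ^ 3 * F) (X ^ 2 + X ^ 4 * F) 0 0 * fromBlocks E 1 F 0
      = (fromBlocks (E * X + X ^ 2 * F) (X + X ^ 3 * F) 0 0 : Matrix (k ⊕ k) (k ⊕ k) ℂ) := by
    rw [fromBlocks_multiply]
    congr 1 <;> simp [add_mul, pow_succ, mul_assoc, hFE, hFF, hc]
  -- The lower row vanishes only from the cube on: the square still has `F` in its lower right
  -- corner.
  have hpow : ∀ j : ℕ, (fromBlocks E 1 F 0 : Matrix (k ⊕ k) (k ⊕ k) ℂ) ^ (j + 3)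
      = fromBlocks (E ^ (j + 3) + E ^ (j + 1) * F) (E ^ (j + 2) + E ^ j * F) 0 0 := by
    intro j
    induction j with
    | zero =>
      simp [pow_succ, fromBlocks_multiply, add_mul, mul_assoc, hFE, hFF]
    | succ j ih =>
      rw [pow_succ, ih, fromBlocks_multiply]
      congr 1 <;> simp [add_mul, pow_succ, mul_assoc, hFE, hFF]
  have hr1 : ∀ j Z, E ^ (r + j + 1) * (X * Z) = E ^ (r + j) * Z := fun j Z => by
    rw [← mul_assoc, show r + j + 1 = j + (r + 1) by omega, pow_add, mul_assoc (E ^ j), ← hr,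
      ← pow_add, add_comm]
  -- At exponent `r + 3` the lowest power of `E` in the blocks is `E^r`, just high enough for `E^r =
  -- E^(r+1) X`.
  refine IsDrazinInverse.drazin_eq ⟨hL.trans hR.symm, ?_, r + 3, ?_⟩
  · rw [hR, fromBlocks_multiply]
    congr 1 <;> simp [mul_add, add_mul, pow_succ, mul_assoc, hs, hs', hFX, hFX']
  · rw [pow_succ _ (r + 3), mul_assoc, hL, hpow, fromBlocks_multiply]
    have e : ∀ Z, E ^ (r + 3) * (E * Z) = E ^ (r + 4) * Z := fun Z => by
      rw [← mul_assoc, ← pow_succ]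
    have h1 := fun Z => hr1 1 Z
    have h2 := fun Z => hr1 2 Z
    have h3 := fun Z => hr1 3 Z
    have h0 := fun Z => hr1 0 Z
    simp only [add_assoc, Nat.reduceAdd, add_zero] at h0 h1 h2 h3
    have h2' : E ^ (r + 3) * X = E ^ (r + 2) := by simpa using h2 1
    have h3' : E ^ (r + 4) * X = E ^ (r + 3) := by simpa using h3 1
    congr 1 <;> simp only [mul_add, add_mul, pow_succ X, pow_zero, one_mul, mul_assoc, e, h0, h1,
      h2, h2', h3', hFE, hFX, hFX', mul_zero, add_zero, ← mul_assoc F, zero_mul]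

end General

/-! ### Collapse of the series when `F² = 0`. -/

section Series

theorem tsum_eq_of_forall_succ {k : Type*} {f : ℕ → Matrix k k ℂ} (hf : ∀ i, f (i + 2) = 0) :
    ∑' i, f i = f 0 + f 1 := by
  rw [tsum_eq_sum (s := Finset.range 2), Finset.sum_range_succ, Finset.sum_range_one]
  intro i hi
  obtain ⟨j, rfl⟩ := Nat.exists_eq_add_of_le' (not_lt.1 (mt Finset.mem_range.2 hi))
  exact hf j

variable {k : Type*} [Fintype k] [DecidableEq k] {E F : Matrix k k ℂ}

theorem coeff_of_drazin_eq_zero (hF : drazin F = 0) (i : ℕ) :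
    coeff E F i = ⟨0, 0, 0, 0⟩ := by
  induction i with
  | zero => simp [coeff, hF]
  | succ i ih => simp [coeff, hF, ih]

theorem pow_add_two_eq_zero (hFF : F * F = 0) (i : ℕ) : F ^ (i + 2) = 0 := by
  rw [pow_add, pow_two, hFF, mul_zero]

theorem eigenproj_of_drazin_eq_zero (hF : drazin F = 0) : eigenproj F = 1 := by
  simp [eigenproj, hF]

theorem seriesConverge_of_mul_self (hFF : F * F = 0) : SeriesConverge E F := by
  have hF := drazin_eq_zero_of_mul_self hFF
  -- Convergence is trivial: every term from index 2 on carries a factor `F^(j+2)` or a vanishing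
  -- coefficient.
  have hsum : ∀ f : ℕ → Matrix k k ℂ, (∀ i, f (i + 2) = 0) → Summable f := fun f hf =>
    summable_of_ne_finset_zero (s := Finset.range 2) fun i hi => by
      obtain ⟨j, rfl⟩ := Nat.exists_eq_add_of_le' (not_lt.1 (mt Finset.mem_range.2 hi))
      exact hf j
  have hp : ∀ i j : ℕ, F ^ (i + (j + 2)) = 0 := fun i j => pow_add_two_eq_zero hFF (i + j)
  have hp' : ∀ j : ℕ, F ^ (j + 2 + 1) = 0 := fun j => pow_add_two_eq_zero hFF (j + 1)
  refine ⟨?_, fun i => ?_, ?_, ?_, ?_, ?_, ?_, ?_, ?_, ?_, ?_⟩ <;> refine hsum _ fun j => ?_ <;>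
    simp [hp, hp', coA, coB, coC, coD, coeff_of_drazin_eq_zero hF]

theorem Gam_of_mul_self (hFF : F * F = 0) : Gam E F = drazin E + drazin E ^ 3 * F := by
  have hF := drazin_eq_zero_of_mul_self hFF
  simp only [Gam, hF, coA, coeff_of_drazin_eq_zero hF, eigenproj_of_drazin_eq_zero hF, mul_zero,
    zero_mul, mul_one, tsum_zero, add_zero]
  rw [tsum_eq_of_forall_succ fun i => by rw [pow_add_two_eq_zero hFF, mul_zero]]
  simp

theorem Del_of_mul_self (hFF : F * F = 0) : Del E F = drazin E ^ 2 + drazin E ^ 4 * F := by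
  have hF := drazin_eq_zero_of_mul_self hFF
  simp only [Del, hF, coB, coeff_of_drazin_eq_zero hF, eigenproj_of_drazin_eq_zero hF, mul_zero,
    zero_mul, mul_one, tsum_zero, add_zero, sub_zero, zero_add]
  rw [tsum_eq_of_forall_succ fun i => by rw [pow_add_two_eq_zero hFF, mul_zero]]
  simp

theorem Lam_of_mul_self (hFF : F * F = 0) : Lam E F = 0 := by
  have hF := drazin_eq_zero_of_mul_self hFF
  simp [Lam, hF, coA, coeff_of_drazin_eq_zero hF]

theorem Xi_of_mul_self (hFF : F * F = 0) : Xi E F = 0 := by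
  have hF := drazin_eq_zero_of_mul_self hFF
  simp [Xi, hF, coB, coeff_of_drazin_eq_zero hF]

end Series

end BlockDrazin

/-! ### The block formulas for `K` and `M`. -/

open BlockDrazin Matrix
theorem theorem3p1 {m n : Type*} [Fintype m] [DecidableEq m] [Fintype n] [DecidableEq n]
    (A : Matrix m m ℂ) (B : Matrix m n ℂ) (C : Matrix n m ℂ) (D : Matrix n n ℂ)
    (hBCB : B * C * B = 0) (hDCB : D * C * B = 0)
    (hBCA : B * C * A * eigenproj (B * C) = 0)
    (hDCA : D * C * A * eigenproj (B * C) = 0) :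
    let M : Matrix (m ⊕ n) (m ⊕ n) ℂ := fromBlocks A B C D
    let E : Matrix (m ⊕ n) (m ⊕ n) ℂ := fromBlocks A B 0 D
    let F : Matrix (m ⊕ n) (m ⊕ n) ℂ := fromBlocks (B * C) 0 (D * C) 0
    let L : Matrix ((m ⊕ n) ⊕ (m ⊕ n)) ((m ⊕ n) ⊕ (m ⊕ n)) ℂ :=
      fromBlocks 0 0 0 (fromBlocks 0 0 C 0)
    let K : Matrix ((m ⊕ n) ⊕ (m ⊕ n)) ((m ⊕ n) ⊕ (m ⊕ n)) ℂ :=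
      fromBlocks (fromBlocks A B 0 D) (fromBlocks (B * C) 0 (D * C) 0) 1 0
    let KD : Matrix ((m ⊕ n) ⊕ (m ⊕ n)) ((m ⊕ n) ⊕ (m ⊕ n)) ℂ :=
      fromBlocks (fromBlocks A B 0 D) 1 1 0
        * fromBlocks (Gam E F) (Del E F) (Lam E F) (Xi E F) ^ 2
        * fromBlocks 1 0 0 (fromBlocks (B * C) 0 (D * C) 0)
    let U : Matrix (m ⊕ n) ((m ⊕ n) ⊕ (m ⊕ n)) ℂ := fromCols 1 (fromBlocks 0 0 C 0)
    let V : Matrix ((m ⊕ n) ⊕ (m ⊕ n)) (m ⊕ n) ℂ := fromRows (fromBlocks A B 0 D) 1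
    SeriesConverge E F ∧
    drazin K = KD ∧
    drazin M = U * (KD + L * KD ^ 2) ^ 2 * V := by
  intro M E F L K KD U V
  have hBC : eigenproj (B * C) = 1 :=
    eigenproj_of_drazin_eq_zero (drazin_eq_zero_of_mul_self (by
      rw [← Matrix.mul_assoc, hBCB, Matrix.zero_mul]))
  rw [hBC, Matrix.mul_one] at hBCA hDCA
  have hFE : F * E = 0 := by
    simp [F, E, fromBlocks_multiply, hBCA, hDCA, hBCB, hDCB]
  have hFF : F * F = 0 := by
    simp [F, fromBlocks_multiply, ← Matrix.mul_assoc, hBCB, hDCB]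
  have hK : drazin K = KD := by
    have hPQ : K = fromBlocks E 1 1 0 * fromBlocks 1 0 0 F := by
      simp [K, E, F, fromBlocks_multiply]
    have hQP : fromBlocks 1 0 0 F * fromBlocks E 1 1 0
        = (fromBlocks E 1 F 0 : Matrix ((m ⊕ n) ⊕ (m ⊕ n)) ((m ⊕ n) ⊕ (m ⊕ n)) ℂ) := by
      simp [fromBlocks_multiply]
    have hKD : KD = fromBlocks E 1 1 0
        -- The explicit blocks are refolded into `E` and `F`, so that `KD` matches Cline's formula.
        * fromBlocks (Gam E F) (Del E F) (Lam E F) (Xi E F) ^ 2 * fromBlocks 1 0 0 F := rfl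
    rw [hKD, hPQ, drazin_mul_comm, hQP, drazin_fromBlocks_one_zero hFE hFF, Gam_of_mul_self hFF,
      Del_of_mul_self hFF, Lam_of_mul_self hFF, Xi_of_mul_self hFF]
  refine ⟨seriesConverge_of_mul_self hFF, hK, ?_⟩
  have hKL : K * L = 0 := by
    simp [K, L, fromBlocks_multiply]
  have hLL : L * L = 0 := by
    simp [L, fromBlocks_multiply]
  have hUV : M = U * V := by
    simp [M, U, V, fromCols_mul_fromRows, fromBlocks_add]
  have hVU : V * U = K + L := by
    simp [K, L, U, V, fromBlocks_add, fromBlocks_multiply]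
  rw [hUV, drazin_mul_comm, hVU, drazin_add_of_mul_eq_zero hKL hLL, hK]
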